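/- Let $n,m\ge 0$, let $\alpha_1,\dots,\alpha_m\in\mathbb C[x_1,\dots,x_n]$ be polynomials of degree one, let $\alpha=\prod_{i=1}^m\alpha_i$, and let $\beta=(\beta_1,\dots,\beta_m)\in\mathbb C^m$. Let $A_n$ be the $n$-th Weyl algebra over $\mathbb C$, generated by $x_1,\dots,x_n,\partial_1,\dots,\partial_n$, and let $M_\alpha^\beta$ be the free $\mathbb C[x]_\alpha$-module of rank one on the generator $\alpha^\beta$, made into an $A_n$-module by $$\partial_j(f\,\alpha^\beta)=\Big(\partial_j f+f\sum_{i=1}^m\beta_i\frac{\partial_j(\alpha_i)}{\alpha_i}\Big)\alpha^\beta\qquad(f\in\mathbb C[x]_\alpha,\ 1\le j\le n),$$ with $x_j$ acting by multiplication. Let $N$ be a decomposition factor of $M_\alpha^\beta$, that is, a simple $A_n$-module isomorphic to a subquotient $Q/P$ with $A_n$-submodules $P\subseteq Q\subseteq M_\alpha^\beta$. Then there is a subset $S\subseteq\{1,\dots,m\}$ such that the support of $N$, that is, the set of points $p\in\mathbb C^n$ at which the localization $N_p$ of $N$ as a $\mathbb C[x_1,\dots,x_n]$-module is nonzero, is the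 intersection of hyperplanes $$\operatorname{Supp}N=\bigcap_{i\in S}\{p\in\mathbb C^n:\alpha_i(p)=0\},$$ where the empty intersection ($S=\emptyset$) is $\mathbb C^n$. -/

import Mathlib

noncomputable section

namespace HyperplaneDModule

open MvPolynomial

/-! ### The Weyl algebra -/

/-- Generators `x_1, …, x_n, ∂_1, …, ∂_n` of the Weyl algebra. -/
inductive WeylGen (n : ℕ) : Type
  | x (i : Fin n) : WeylGen n
  | d (i : Fin n) : WeylGen n

/-- The defining relations of the Weyl algebra:
`[x_i, x_j] = 0`, `[∂_i, ∂_j] = 0`, `[∂_i, x_j] = δ_{ij}`. -/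
inductive WeylRel (n : ℕ) : FreeAlgebra ℂ (WeylGen n) → FreeAlgebra ℂ (WeylGen n) → Prop
  | x_comm (i j : Fin n) : WeylRel n
      (FreeAlgebra.ι ℂ (WeylGen.x i) * FreeAlgebra.ι ℂ (WeylGen.x j))
      (FreeAlgebra.ι ℂ (WeylGen.x j) * FreeAlgebra.ι ℂ (WeylGen.x i))
  | d_comm (i j : Fin n) : WeylRel n
      (FreeAlgebra.ι ℂ (WeylGen.d i) * FreeAlgebra.ι ℂ (WeylGen.d j))
      (FreeAlgebra.ι ℂ (WeylGen.d j) * FreeAlgebra.ι ℂ (WeylGen.d i))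
  | d_x (i j : Fin n) : WeylRel n
      (FreeAlgebra.ι ℂ (WeylGen.d i) * FreeAlgebra.ι ℂ (WeylGen.x j))
      (FreeAlgebra.ι ℂ (WeylGen.x j) * FreeAlgebra.ι ℂ (WeylGen.d i) + if i = j then 1 else 0)

/-- The `n`-th Weyl algebra `A_n` over `ℂ`, by generators and relations. -/
def Weyl (n : ℕ) : Type := RingQuot (WeylRel n)

instance (n : ℕ) : Ring (Weyl n) := inferInstanceAs (Ring (RingQuot (WeylRel n)))

instance (n : ℕ) : Algebra ℂ (Weyl n) := inferInstanceAs (Algebra ℂ (RingQuot (WeylRel n)))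

namespace Weyl

variable {n : ℕ}

/-- The element `x_i` of the Weyl algebra. -/
def x (i : Fin n) : Weyl n :=
  RingQuot.mkAlgHom ℂ (WeylRel n) (FreeAlgebra.ι ℂ (WeylGen.x i))

/-- The element `∂_i` of the Weyl algebra. -/
def d (i : Fin n) : Weyl n :=
  RingQuot.mkAlgHom ℂ (WeylRel n) (FreeAlgebra.ι ℂ (WeylGen.d i))

theorem x_mul_x (i j : Fin n) : x i * x j = x j * x i := by
  have h := RingQuot.mkAlgHom_rel ℂ (WeylRel.x_comm i j)
  rw [map_mul, map_mul] at h
  exact h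

theorem d_mul_d (i j : Fin n) : d i * d j = d j * d i := by
  have h := RingQuot.mkAlgHom_rel ℂ (WeylRel.d_comm i j)
  rw [map_mul, map_mul] at h
  exact h

theorem d_mul_x (i j : Fin n) : d i * x j = x j * d i + if i = j then 1 else 0 := by
  have h := RingQuot.mkAlgHom_rel ℂ (WeylRel.d_x i j)
  rw [map_add, map_mul, map_mul, apply_ite (RingQuot.mkAlgHom ℂ (WeylRel n)), map_one,
    map_zero] at h
  exact h

/-- The universal property of the Weyl algebra: elements of a `ℂ`-algebra satisfying the
defining relations determine an algebra homomorphism. -/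
def lift {B : Type*} [Ring B] [Algebra ℂ B] (X D : Fin n → B)
    (hX : ∀ i j, X i * X j = X j * X i) (hD : ∀ i j, D i * D j = D j * D i)
    (hDX : ∀ i j, D i * X j = X j * D i + if i = j then 1 else 0) : Weyl n →ₐ[ℂ] B :=
  RingQuot.liftAlgHom ℂ
    ⟨FreeAlgebra.lift ℂ (fun g : WeylGen n => WeylGen.casesOn g X D), by
      intro a b h
      cases h with
      | x_comm i j => simpa using hX i j
      | d_comm i j => simpa using hD i j
      | d_x i j => 
        have := hDX i j
        split_ifs at this ⊢ <;> simpa using this⟩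

section lift

variable {B : Type*} [Ring B] [Algebra ℂ B] (X D : Fin n → B)
    (hX : ∀ i j, X i * X j = X j * X i) (hD : ∀ i j, D i * D j = D j * D i)
    (hDX : ∀ i j, D i * X j = X j * D i + if i = j then 1 else 0)

theorem lift_x (i : Fin n) : lift X D hX hD hDX (x i) = X i := by
  refine (RingQuot.liftAlgHom_mkAlgHom_apply _ _ _ _).trans ?_
  simp

theorem lift_d (i : Fin n) : lift X D hX hD hDX (d i) = D i := by
  refine (RingQuot.liftAlgHom_mkAlgHom_apply _ _ _ _).trans ?_
  simp

end lift

/-- The canonical homomorphism `ℂ[x_1, …, x_n] → A_n`, `x_i ↦ x_i`. -/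
def ofPoly (n : ℕ) : MvPolynomial (Fin n) ℂ →ₐ[ℂ] Weyl n :=
  letI : CommRing (Algebra.adjoin ℂ (Set.range (x : Fin n → Weyl n))) :=
    { (inferInstance : Ring (Algebra.adjoin ℂ (Set.range (x : Fin n → Weyl n)))) with
      mul_comm := (Algebra.isMulCommutative_adjoin ℂ (by
        rintro _ ⟨i, rfl⟩ _ ⟨j, rfl⟩
        exact x_mul_x i j)).is_comm.comm }
  (Algebra.adjoin ℂ (Set.range (x : Fin n → Weyl n))).val.comp
    (MvPolynomial.aeval fun i => ⟨x i, Algebra.subset_adjoin ⟨i, rfl⟩⟩)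

theorem ofPoly_X (i : Fin n) : ofPoly n (X i) = x i := by
  simp [ofPoly]

end Weyl

/-! ### Support and decomposition factors of `A_n`-modules -/

/-- The support in `ℂ^n` of an `A_n`-module `N`: regard `N` as a module over `ℂ[x_1, …, x_n]` by
restriction of scalars, and take the points at (the maximal ideals of) which its localization is
nonzero. -/
def supp (n : ℕ) (N : Type*) [AddCommGroup N] [Module (Weyl n) N] : Set (Fin n → ℂ) :=
  letI : Module (MvPolynomial (Fin n) ℂ) N := Module.compHom N (Weyl.ofPoly n).toRingHom
  {p | (pointToPoint p : PrimeSpectrum (MvPolynomial (Fin n) ℂ)) ∈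
    Module.support (MvPolynomial (Fin n) ℂ) N}

/-- `N` is a decomposition factor of the `R`-module `M`: it is simple, and isomorphic to a
subquotient `Q / P` with `P ≤ Q ≤ M`. -/
def IsDecompositionFactor (R : Type*) [Ring R] (N M : Type*) [AddCommGroup N] [Module R N]
    [AddCommGroup M] [Module R M] : Prop :=
  IsSimpleModule R N ∧
    ∃ P Q : Submodule R M, P ≤ Q ∧ Nonempty (N ≃ₗ[R] (Q ⧸ P.submoduleOf Q))

/-! ### Extending derivations to a localization -/

section Derivation

variable {k A : Type*} [CommRing k] [CommRing A] [Algebra k A] (δ : Derivation k A A) (a : A)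

/-- The homomorphism `A → A_a[ε]`, `f ↦ f + δ(f) ε`. -/
def dualHom : A →ₐ[k] DualNumber (Localization.Away a) where
  toFun f := TrivSqZeroExt.inl (algebraMap A _ f) + TrivSqZeroExt.inr (algebraMap A _ (δ f))
  map_one' := by ext <;> simp
  map_zero' := by ext <;> simp
  map_add' f g := by ext <;> simp [add_smul]
  map_mul' f g := by
    ext
    · simp
    · simp only [TrivSqZeroExt.snd_add, TrivSqZeroExt.snd_inl, TrivSqZeroExt.snd_inr,
        TrivSqZeroExt.snd_mul, TrivSqZeroExt.fst_add, TrivSqZeroExt.fst_inl,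
        TrivSqZeroExt.fst_inr, Derivation.leibniz, map_add, map_mul, smul_eq_mul,
        MulOpposite.smul_eq_mul_unop, MulOpposite.unop_op, add_zero, zero_add]
      ring
  commutes' c := by
    rw [TrivSqZeroExt.algebraMap_eq_inl']
    ext <;> simp [← IsScalarTower.algebraMap_apply]

theorem dualHom_isUnit (s : Submonoid.powers a) : IsUnit (dualHom δ a s) := by
  rw [TrivSqZeroExt.isUnit_iff_isUnit_fst]
  simpa [dualHom] using IsLocalization.map_units (Localization.Away a) s

/-- The homomorphism `A_a → A_a[ε]` extending `dualHom`. -/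
def dualLift : Localization.Away a →ₐ[k] DualNumber (Localization.Away a) :=
  IsLocalization.liftAlgHom (M := Submonoid.powers a) (f := dualHom δ a) (dualHom_isUnit δ a)

theorem dualLift_algebraMap (f : A) :
    dualLift δ a (algebraMap A _ f) = dualHom δ a f := by
  simp [dualLift]

theorem dualLift_fst (z : Localization.Away a) : (dualLift δ a z).fst = z := by
  have h : ((TrivSqZeroExt.fstHom k (Localization.Away a) (Localization.Away a)).comp
      (dualLift δ a) : Localization.Away a →+* Localization.Away a) = RingHom.id _ := by
    apply IsLocalization.ringHom_ext (Submonoid.powers a)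
    ext f
    simp [dualLift_algebraMap, dualHom]
  exact congrArg (fun g => g z) h

/-- The (unique) extension of a derivation of `A` to the localization `A_a`. -/
def awayDerivation : Derivation k (Localization.Away a) (Localization.Away a) :=
  Derivation.mk'
    ((TrivSqZeroExt.sndHom (Localization.Away a) (Localization.Away a)).restrictScalars k ∘ₗ
      (dualLift δ a).toLinearMap) (by
    intro y z
    simp [dualLift_fst, mul_comm])

theorem awayDerivation_algebraMap (f : A) :
    awayDerivation δ a (algebraMap A _ f) = algebraMap A _ (δ f) := by
  change (dualLift δ a (algebraMap A _ f)).snd = _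
  rw [dualLift_algebraMap]
  change (TrivSqZeroExt.inl (algebraMap A (Localization.Away a) f) +
    TrivSqZeroExt.inr (algebraMap A (Localization.Away a) (δ f)) :
      DualNumber (Localization.Away a)).snd = _
  rw [TrivSqZeroExt.snd_add, TrivSqZeroExt.snd_inl, TrivSqZeroExt.snd_inr, zero_add]

theorem derivation_ext_away {D₁ D₂ : Derivation k (Localization.Away a) (Localization.Away a)}
    (h : ∀ f : A, D₁ (algebraMap A _ f) = D₂ (algebraMap A _ f)) : D₁ = D₂ := by
  ext z
  obtain ⟨⟨f, s⟩, hz⟩ := IsLocalization.surj (Submonoid.powers a) z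
  have h₁ := congrArg D₁ hz
  have h₂ := congrArg D₂ hz
  simp only [Derivation.leibniz, h, smul_eq_mul] at h₁ h₂
  have h3 := h₁.trans h₂.symm
  exact (IsLocalization.map_units (Localization.Away a) s).mul_left_cancel (add_left_cancel h3)

theorem derivation_dlog {k B : Type*} [CommRing k] [CommRing B] [Algebra k B]
    (D₁ D₂ : Derivation k B B) {b c : B} (hb : c * b = 1) (h : D₁ (D₂ b) = D₂ (D₁ b)) :
    D₁ (D₂ b * c) = D₂ (D₁ b * c) := by
  rw [Derivation.leibniz, Derivation.leibniz, Derivation.leibniz_of_mul_eq_one _ hb,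
    Derivation.leibniz_of_mul_eq_one _ hb, h]
  simp only [smul_eq_mul]
  ring

end Derivation

/-! ### The module `M_α^β` -/

section Twisted

variable {n m : ℕ} (α : Fin m → MvPolynomial (Fin n) ℂ) (β : Fin m → ℂ)

/-- `ℂ[x]_α`, the localization of `ℂ[x_1, …, x_n]` at the product `α = α_1 ⋯ α_m`. -/
abbrev Loc : Type := Localization.Away (∏ k, α k)

/-- The canonical map `ℂ[x_1, …, x_n] → ℂ[x]_α`. -/
abbrev toLoc : MvPolynomial (Fin n) ℂ →+* Loc α := algebraMap (MvPolynomial (Fin n) ℂ) (Loc α)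

/-- The derivation `∂_j` of `ℂ[x]_α` extending the partial derivative. -/
def locD (j : Fin n) : Derivation ℂ (Loc α) (Loc α) := awayDerivation (pderiv j) (∏ k, α k)

theorem isUnit_loc (k : Fin m) : IsUnit (toLoc α (α k)) :=
  isUnit_of_dvd_unit (map_dvd _ (Finset.dvd_prod_of_mem α (Finset.mem_univ k)))
    (IsLocalization.Away.algebraMap_isUnit (∏ k, α k))

/-- `∑ k, β_k ∂_j(α_k) / α_k`, an element of `ℂ[x]_α`. The inverse is a genuine one,
by `isUnit_loc`. -/
def logD (j : Fin n) : Loc α :=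
  ∑ k, β k • (toLoc α (pderiv j (α k)) * Ring.inverse (toLoc α (α k)))

theorem pderiv_comm (i j : Fin n) (p : MvPolynomial (Fin n) ℂ) :
    pderiv i (pderiv j p) = pderiv j (pderiv i p) := by
  let D (i : Fin n) : Derivation ℂ (MvPolynomial (Fin n) ℂ) (MvPolynomial (Fin n) ℂ) := pderiv i
  have hp : ⁅D i, D j⁆ = 0 := by
    apply MvPolynomial.derivation_ext
    intro l
    simp [D, Derivation.commutator_apply, pderiv_X, Pi.single_apply, apply_ite]
  have h := congrArg (fun D => D p) hp
  rw [Derivation.commutator_apply] at h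
  exact sub_eq_zero.mp h

theorem locD_toLoc (j : Fin n) (p : MvPolynomial (Fin n) ℂ) :
    locD α j (toLoc α p) = toLoc α (pderiv j p) :=
  awayDerivation_algebraMap _ _ _

theorem locD_comm (i j : Fin n) (f : Loc α) :
    locD α i (locD α j f) = locD α j (locD α i f) := by
  have h : ⁅locD α i, locD α j⁆ = 0 := by
    apply derivation_ext_away
    intro p
    change ⁅locD α i, locD α j⁆ (toLoc α p) = 0
    rw [Derivation.commutator_apply, locD_toLoc, locD_toLoc, locD_toLoc, locD_toLoc,
      pderiv_comm, sub_self]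
  have h' := congrArg (fun D => D f) h
  rw [Derivation.commutator_apply] at h'
  exact sub_eq_zero.mp h'

theorem locD_logD (i j : Fin n) : locD α i (logD α β j) = locD α j (logD α β i) := by
  rw [logD, logD, map_sum, map_sum]
  refine Finset.sum_congr rfl fun k _ => ?_
  rw [Derivation.map_smul, Derivation.map_smul, ← locD_toLoc, ← locD_toLoc,
    derivation_dlog (locD α i) (locD α j) (Ring.inverse_mul_cancel _ (isUnit_loc α k))
      (locD_comm α i j _)]

/-- The module `M_α^β`: the free `ℂ[x]_α`-module of rank one on the generator `α^β`.
The element `f : Loc α` of the underlying type stands for `f α^β`. -/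
def Twisted (_α : Fin m → MvPolynomial (Fin n) ℂ) (_β : Fin m → ℂ) : Type := Loc _α

instance : AddCommGroup (Twisted α β) := inferInstanceAs (AddCommGroup (Loc α))

instance : Module (Loc α) (Twisted α β) := inferInstanceAs (Module (Loc α) (Loc α))

instance : Module ℂ (Twisted α β) := inferInstanceAs (Module ℂ (Loc α))

/-- The operator `f α^β ↦ x_j f α^β`. -/
def opX (j : Fin n) : Module.End ℂ (Twisted α β) :=
  (LinearMap.mulLeft ℂ (toLoc α (X j)) : Loc α →ₗ[ℂ] Loc α)

/-- The operator `f α^β ↦ (∂_j f + f ∑ k, β_k ∂_j(α_k) / α_k) α^β`. -/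
def opD (j : Fin n) : Module.End ℂ (Twisted α β) :=
  ((locD α j : Loc α →ₗ[ℂ] Loc α) + LinearMap.mulLeft ℂ (logD α β j) : Loc α →ₗ[ℂ] Loc α)

theorem opX_apply (j : Fin n) (f : Loc α) :
    (opX α β j : Loc α → Loc α) f = toLoc α (X j) * f := rfl

theorem opD_apply (j : Fin n) (f : Loc α) :
    (opD α β j : Loc α → Loc α) f = locD α j f + logD α β j * f := rfl

/-- The action of the Weyl algebra on `M_α^β`. -/
def weylAction : Weyl n →ₐ[ℂ] Module.End ℂ (Twisted α β) :=
  Weyl.lift (opX α β) (opD α β)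
    (by
      intro i j
      refine LinearMap.ext fun (f : Loc α) => ?_
      change toLoc α (X i) * (toLoc α (X j) * f) =
        toLoc α (X j) * (toLoc α (X i) * f)
      ring)
    (by
      intro i j
      refine LinearMap.ext fun (f : Loc α) => ?_
      change locD α i (locD α j f + logD α β j * f) +
          logD α β i * (locD α j f + logD α β j * f) =
        locD α j (locD α i f + logD α β i * f) +
          logD α β j * (locD α i f + logD α β i * f)
      simp only [map_add, Derivation.leibniz, smul_eq_mul]
      rw [locD_comm α i j f, locD_logD α β i j]
      ring)
    (by
      intro i j
      refine LinearMap.ext fun (f : Loc α) => ?_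
      have hX : locD α i (toLoc α (X j)) = if i = j then 1 else 0 := by
        rw [locD_toLoc, pderiv_X, Pi.single_apply]
        split_ifs <;> simp_all
      have key : locD α i (toLoc α (X j) * f) +
          logD α β i * (toLoc α (X j) * f) =
          toLoc α (X j) * (locD α i f + logD α β i * f) +
            (if i = j then f else 0) := by
        rw [Derivation.leibniz, hX]
        split_ifs <;> simp only [smul_eq_mul, mul_one, mul_zero] <;> ring
      refine Eq.trans key ?_
      split_ifs <;> rfl)

instance : Module (Weyl n) (Twisted α β) :=
  Module.compHom (Twisted α β) (weylAction α β).toRingHom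

/-- The generator `α^β` of `M_α^β`. -/
def gen : Twisted α β := (1 : Loc α)

/-- `∂_j α^β = (∑ k, β_k ∂_j(α_k) / α_k) α^β`. -/
theorem d_smul_gen (j : Fin n) : Weyl.d j • gen α β = logD α β j • gen α β := by
  change weylAction α β (Weyl.d j) (gen α β) = _
  rw [weylAction, Weyl.lift_d]
  change locD α j 1 + logD α β j * 1 = logD α β j * 1
  simp

/-- The Leibniz rule `∂_j (f u) = ∂_j(f) u + f ∂_j u` for `f ∈ ℂ[x]_α`, `u ∈ M_α^β`. -/
theorem d_smul_smul (j : Fin n) (f : Loc α) (u : Twisted α β) :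
    Weyl.d j • (f • u) = locD α j f • u + f • (Weyl.d j • u) := by
  change weylAction α β (Weyl.d j) (f • u) = _ + f • weylAction α β (Weyl.d j) u
  rw [weylAction, Weyl.lift_d]
  revert u
  intro (u : Loc α)
  change locD α j (f * u) + logD α β j * (f * u) =
    locD α j f * u + f * (locD α j u + logD α β j * u)
  rw [Derivation.leibniz]
  simp only [smul_eq_mul]
  ring

/-- `x_j` acts on `M_α^β` as multiplication by `x_j ∈ ℂ[x]_α`. -/
theorem x_smul (j : Fin n) (u : Twisted α β) :
    Weyl.x j • u = toLoc α (X j) • u := by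
  change weylAction α β (Weyl.x j) u = _
  rw [weylAction, Weyl.lift_x]
  rfl

end Twisted

/-- The affine subset `⋂_{i ∈ S} V(α_i)` of `ℂ^n`; all of `ℂ^n` for `S = ∅`. -/
def flat {n m : ℕ} (α : Fin m → MvPolynomial (Fin n) ℂ) (S : Set (Fin m)) : Set (Fin n → ℂ) :=
  ⋂ i ∈ S, {p | eval p (α i) = 0}

end HyperplaneDModule

end

noncomputable section

namespace HyperplaneDModule

open MvPolynomial

/-! The elements of `N` killed by a power of `α i` form a Weyl submodule (`Weyl.torsion`), so
simplicity makes it zero or everything. Let `S` collect the `i` for which it is everything. Then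
`Supp N` lies in `flat α S`, and every `α i` with `i ∉ S` acts injectively on `N`.

For the other inclusion, invert `g = ∏ i ∈ Sᶜ, α i`; nothing in `N` is lost. Along a direction `w`
tangent to the flat, the twist `logDir` has only factors of `g` in its denominator, so the untwisted
derivative along `w` preserves the localized `P` and `Q` (`DStable.locDir_mem_saturation`). Choose
`u` in the localized `Q`, not in the localized `P`, whose numerator over a fixed power of `∏ i ∈ S,
α i` has least degree. Tangential derivatives lower that degree, so they send `u` into the localized
`P`, and the annihilator `I` of the class of `u` is stable under them.

`I` is proper, so it has a zero `q` by the Nullstellensatz, and torsion puts `q` on the flat. For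
`p` on the flat, `p - q` is tangent. Zeros of `I` are stable under translation by tangent vectors
(`eval_add_eq_zero_of_dirDeriv_stable`), so `p` is a zero of `I` too. Clearing denominators gives an
element of `N` supported at `p`. -/

theorem sum_derivation_apply {k A ι : Type*} [CommRing k] [CommRing A] [Algebra k A]
    (s : Finset ι) (D : ι → Derivation k A A) (a : A) : (∑ j ∈ s, D j) a = ∑ j ∈ s, D j a := by
  classical
  induction s using Finset.induction_on with
  | empty => simp
  | insert i s hi ih => rw [Finset.sum_insert hi, Finset.sum_insert hi, Derivation.add_apply, ih]

/-! ### Directional derivatives of polynomials -/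

section DirDeriv

variable {n : ℕ}

/-- The derivative `∑ j, w_j ∂_j` in the direction `w`. -/
def dirDeriv (w : Fin n → ℂ) : Derivation ℂ (MvPolynomial (Fin n) ℂ) (MvPolynomial (Fin n) ℂ) :=
  ∑ j, w j • pderiv j

theorem dirDeriv_apply (w : Fin n → ℂ) (f : MvPolynomial (Fin n) ℂ) :
    dirDeriv w f = ∑ j, w j • pderiv j f := by
  simp [dirDeriv, sum_derivation_apply]

theorem pderiv_eq_zero_of_totalDegree_eq_zero {f : MvPolynomial (Fin n) ℂ}
    (hf : f.totalDegree = 0) (j : Fin n) : pderiv j f = 0 := by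
  rw [totalDegree_eq_zero_iff_eq_C.mp hf, pderiv_C]

theorem totalDegree_pderiv_le {f : MvPolynomial (Fin n) ℂ} (j : Fin n) :
    (pderiv j f).totalDegree ≤ f.totalDegree - 1 := by
  rw [totalDegree, Finset.sup_le_iff]
  intro s hs
  rw [mem_support_iff, coeff_pderiv] at hs
  have h := le_totalDegree (mem_support_iff.mpr (left_ne_zero_of_mul hs))
  rw [Finsupp.sum_add_index' (fun _ => rfl) (fun _ _ _ => rfl),
    Finsupp.sum_single_index rfl] at h
  exact Nat.le_sub_of_add_le h

theorem totalDegree_dirDeriv_le (w : Fin n → ℂ) (f : MvPolynomial (Fin n) ℂ) :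
    (dirDeriv w f).totalDegree ≤ f.totalDegree - 1 := by
  rw [dirDeriv_apply]
  exact (totalDegree_finsetSum _ _).trans <| Finset.sup_le fun j _ =>
    (totalDegree_smul_le _ _).trans (totalDegree_pderiv_le j)

theorem dirDeriv_eq_zero_of_totalDegree_eq_zero (w : Fin n → ℂ) {f : MvPolynomial (Fin n) ℂ}
    (hf : f.totalDegree = 0) : dirDeriv w f = 0 := by
  rw [dirDeriv_apply]
  exact Finset.sum_eq_zero fun j _ => by
    rw [pderiv_eq_zero_of_totalDegree_eq_zero hf, smul_zero]

/-- Restriction of polynomials to the line `t ↦ p + t w`. -/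
def restrictLine (p w : Fin n → ℂ) : MvPolynomial (Fin n) ℂ →ₐ[ℂ] Polynomial ℂ :=
  aeval fun i => Polynomial.C (p i) + Polynomial.X * Polynomial.C (w i)

theorem eval_restrictLine (p w : Fin n → ℂ) (t : ℂ) (f : MvPolynomial (Fin n) ℂ) :
    (restrictLine p w f).eval t = eval (p + t • w) f := by
  have h : (Polynomial.evalRingHom t).comp (restrictLine p w).toRingHom = eval (p + t • w) := by
    apply MvPolynomial.ringHom_ext
    · intro r
      simp [restrictLine]
    · intro i
      simp [restrictLine, mul_comm t]
  exact congrArg (fun φ => φ f) h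

theorem derivative_restrictLine (p w : Fin n → ℂ) (f : MvPolynomial (Fin n) ℂ) :
    Polynomial.derivative (restrictLine p w f) = restrictLine p w (dirDeriv w f) := by
  induction f using MvPolynomial.induction_on with
  | C a =>
    rw [dirDeriv_eq_zero_of_totalDegree_eq_zero w (totalDegree_C a), map_zero]
    simp [restrictLine]
  | add f g hf hg => rw [map_add, map_add, hf, hg, map_add, map_add]
  | mul_X f i hf =>
    have hX : restrictLine p w (dirDeriv w (X i)) = Polynomial.derivative
        (restrictLine p w (X i)) := by
      simp [restrictLine, dirDeriv_apply, pderiv_X, Pi.single_apply, Polynomial.smul_eq_C_mul]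
    rw [map_mul, Polynomial.derivative_mul, hf, Derivation.leibniz, map_add, smul_eq_mul,
      smul_eq_mul, map_mul, map_mul, hX]
    ring

/-- On the line through `p` and `q` the polynomial is affine in the parameter, with slope the
constant `dirDeriv (q - p) f`; vanishing at both 0 and 1 forces slope zero. -/
theorem dirDeriv_eq_zero_of_eval_eq_zero {f : MvPolynomial (Fin n) ℂ} (hf : f.totalDegree = 1)
    {p q : Fin n → ℂ} (hp : eval p f = 0) (hq : eval q f = 0) : dirDeriv (q - p) f = 0 := by
  have h0 : (dirDeriv (q - p) f).totalDegree = 0 := by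
    have := totalDegree_dirDeriv_le (q - p) f
    omega
  obtain ⟨c, hc⟩ : ∃ c, dirDeriv (q - p) f = C c := ⟨_, totalDegree_eq_zero_iff_eq_C.mp h0⟩
  have hd : Polynomial.derivative
      (restrictLine p (q - p) f - Polynomial.C c * Polynomial.X) = 0 := by
    rw [Polynomial.derivative_sub, derivative_restrictLine, hc]
    simp [restrictLine]
  have hC := Polynomial.eq_C_of_natDegree_eq_zero
    (Polynomial.derivative_eq_zero.mp hd)
  have e0 := congrArg (Polynomial.eval 0) hC
  have e1 := congrArg (Polynomial.eval 1) hC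
  simp only [Polynomial.eval_sub, eval_restrictLine, Polynomial.eval_mul, Polynomial.eval_C,
    Polynomial.eval_X, zero_smul, add_zero, hp, one_smul, add_sub_cancel, hq, mul_zero] at e0 e1
  rw [← e0] at e1
  have : c = 0 := by simpa using e1
  rw [hc, this, C_0]

/-- The zero locus of an ideal stable under `∑ j, w_j ∂_j` is stable under translation by `w`. -/
theorem eval_add_eq_zero_of_dirDeriv_stable {I : Ideal (MvPolynomial (Fin n) ℂ)}
    {w : Fin n → ℂ} (hI : ∀ f ∈ I, dirDeriv w f ∈ I) {p : Fin n → ℂ}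
    (hp : ∀ f ∈ I, eval p f = 0) {f : MvPolynomial (Fin n) ℂ} (hf : f ∈ I) :
    eval (p + w) f = 0 := by
  -- Induction on the degree along the line, for all of `I` at once: the derivative of a restriction
  -- is again the restriction of an element of `I`, so it vanishes, and the remaining constant is
  -- `f(p) = 0`.
  have key : ∀ k, ∀ f ∈ I, (restrictLine p w f).natDegree < k → restrictLine p w f = 0 := by
    intro k
    induction k with
    | zero => exact fun _ _ h => absurd h (Nat.not_lt_zero _)
    | succ k ih =>
      intro f hf hk
      have hd : Polynomial.derivative (restrictLine p w f) = 0 := by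
        by_cases h0 : (restrictLine p w f).natDegree = 0
        · rw [Polynomial.eq_C_of_natDegree_eq_zero h0, Polynomial.derivative_C]
        · have hlt := Polynomial.natDegree_derivative_lt h0
          rw [derivative_restrictLine] at hlt ⊢
          exact ih _ (hI f hf) (by omega)
      have hC := Polynomial.eq_C_of_natDegree_eq_zero
        (Polynomial.derivative_eq_zero.mp hd)
      have e0 := eval_restrictLine p w 0 f
      rw [zero_smul, add_zero, hp f hf, ← Polynomial.coeff_zero_eq_eval_zero] at e0
      rw [hC, e0, Polynomial.C_0]
  have := eval_restrictLine p w 1 f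
  rw [key _ f hf (Nat.lt_succ_self _), one_smul, Polynomial.eval_zero] at this
  exact this.symm

/-- Weak Nullstellensatz: an empty zero locus would make the radical, hence `I`, the unit ideal. -/
theorem exists_eval_eq_zero_of_ne_top {I : Ideal (MvPolynomial (Fin n) ℂ)} (hI : I ≠ ⊤) :
    ∃ p, ∀ f ∈ I, eval p f = 0 := by
  by_contra! h
  apply hI
  have hz : zeroLocus ℂ I = ∅ := by
    refine Set.eq_empty_of_forall_notMem fun p hp => ?_
    obtain ⟨f, hf, hne⟩ := h p
    exact hne (by simpa [aeval_eq_eval] using hp f hf)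
  have := vanishingIdeal_zeroLocus_eq_radical (K := ℂ) I
  rw [hz, vanishingIdeal_empty] at this
  exact Ideal.radical_eq_top.mp this.symm

end DirDeriv

/-! ### Modules over the Weyl algebra -/

namespace Weyl

variable {n : ℕ}

/-- Induction on the Weyl algebra. -/
theorem induction {C : Weyl n → Prop} (algebraMap : ∀ c, C (algebraMap ℂ (Weyl n) c))
    (x : ∀ i, C (x i)) (d : ∀ i, C (d i)) (mul : ∀ a b, C a → C b → C (a * b))
    (add : ∀ a b, C a → C b → C (a + b)) (a : Weyl n) : C a := by
  obtain ⟨y, rfl⟩ := RingQuot.mkAlgHom_surjective ℂ (WeylRel n) a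
  induction y using FreeAlgebra.induction with
  | grade0 r =>
    rw [AlgHom.commutes]
    exact algebraMap r
  | grade1 g =>
    cases g with
    | x i => exact x i
    | d i => exact d i
  | mul a b ha hb => 
    rw [map_mul]
    exact mul _ _ ha hb
  | add a b ha hb =>
    rw [map_add]
    exact add _ _ ha hb

theorem d_mul_ofPoly (j : Fin n) (f : MvPolynomial (Fin n) ℂ) :
    d j * ofPoly n f = ofPoly n f * d j + ofPoly n (pderiv j f) := by
  induction f using MvPolynomial.induction_on with
  | C a =>
    rw [pderiv_C, map_zero, add_zero, ← algebraMap_eq, AlgHom.commutes, Algebra.commutes]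
  | add f g hf hg =>
    simp only [map_add, mul_add, add_mul, hf, hg]
    abel
  | mul_X f i hf =>
    rw [map_mul, ← mul_assoc, hf, add_mul, mul_assoc, ofPoly_X, d_mul_x, Derivation.leibniz,
      map_add, smul_eq_mul, smul_eq_mul, map_mul, map_mul, mul_add, pderiv_X, Pi.single_apply,
      ← ofPoly_X, ← map_mul (ofPoly n) (X i), mul_comm (X i), map_mul, ← mul_assoc, add_assoc]
    simp only [apply_ite (ofPoly n), map_one, map_zero, eq_comm (a := i)]

variable {N : Type*} [AddCommGroup N] [Module (Weyl n) N]

theorem ofPoly_pow_smul_eq_zero_of_le {a : MvPolynomial (Fin n) ℂ} {u : N} {k l : ℕ}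
    (hkl : k ≤ l) (h : ofPoly n (a ^ k) • u = 0) : ofPoly n (a ^ l) • u = 0 := by
  rw [← Nat.sub_add_cancel hkl, pow_add, map_mul, mul_smul, h, smul_zero]

/-- The submodule of elements killed by a power of the polynomial `a`. -/
def torsion (N : Type*) [AddCommGroup N] [Module (Weyl n) N] (a : MvPolynomial (Fin n) ℂ) :
    Submodule (Weyl n) N where
  carrier := {u | ∃ k, ofPoly n (a ^ k) • u = 0}
  zero_mem' := ⟨0, smul_zero _⟩
  add_mem' := by
    rintro u v ⟨k, hk⟩ ⟨l, hl⟩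
    refine ⟨k + l, ?_⟩
    rw [smul_add, ofPoly_pow_smul_eq_zero_of_le (Nat.le_add_right k l) hk,
      ofPoly_pow_smul_eq_zero_of_le (Nat.le_add_left l k) hl, add_zero]
  smul_mem' := by
    intro c
    induction c using Weyl.induction with
    | algebraMap c =>
      rintro u ⟨k, hk⟩
      exact ⟨k, by rw [← mul_smul, ← Algebra.commutes, mul_smul, hk, smul_zero]⟩
    | x i =>
      rintro u ⟨k, hk⟩
      exact ⟨k, by rw [← ofPoly_X, ← mul_smul, ← map_mul, mul_comm, map_mul, mul_smul, hk,
        smul_zero]⟩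
    | d i =>
      rintro u ⟨k, hk⟩
      -- Commuting `∂_i` past `a ^ (k + 1)` leaves `∂_i(a ^ (k + 1))`, which is still divisible by
      -- `a ^ k`.
      refine ⟨k + 1, ?_⟩
      rw [← mul_smul, ← add_sub_cancel_right (ofPoly n (a ^ (k + 1)) * d i)
        (ofPoly n (pderiv i (a ^ (k + 1)))), ← d_mul_ofPoly, sub_smul, mul_smul]
      have h1 : ofPoly n (a ^ (k + 1)) • u = 0 := by
        rw [pow_succ', map_mul, mul_smul, hk, smul_zero]
      have h2 : ofPoly n (pderiv i (a ^ (k + 1))) • u = 0 := by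
        rw [pderiv_pow, Nat.add_sub_cancel, mul_right_comm, map_mul, mul_smul, hk, smul_zero]
      rw [h1, h2, smul_zero, sub_zero]
    | mul a b ha hb =>
      intro u hu
      rw [mul_smul]
      exact ha (hb hu)
    | add b c hb hc =>
      intro u hu
      obtain ⟨k, hk⟩ := hb hu
      obtain ⟨l, hl⟩ := hc hu
      refine ⟨k + l, ?_⟩
      rw [add_smul, smul_add, ofPoly_pow_smul_eq_zero_of_le (Nat.le_add_right k l) hk,
        ofPoly_pow_smul_eq_zero_of_le (Nat.le_add_left l k) hl, add_zero]

end Weyl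

/-- The localization at `p` is nonzero iff some element is killed by no polynomial that is nonzero
at `p`; no finiteness of `N` is needed. -/
theorem mem_supp {n : ℕ} {N : Type*} [AddCommGroup N] [Module (Weyl n) N] {p : Fin n → ℂ} :
    p ∈ supp n N ↔ ∃ u : N, ∀ f, Weyl.ofPoly n f • u = 0 → eval p f = 0 := by
  let : Module (MvPolynomial (Fin n) ℂ) N := Module.compHom N (Weyl.ofPoly n).toRingHom
  refine Module.mem_support_iff'.trans ?_
  refine exists_congr fun u => forall_congr' fun f => ?_
  have : f ∈ (pointToPoint p : PrimeSpectrum (MvPolynomial (Fin n) ℂ)).asIdeal ↔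
      eval p f = 0 := by
    change f ∈ vanishingIdeal ℂ {p} ↔ _
    rw [mem_vanishingIdeal_singleton_iff, aeval_eq_eval]
  rw [this]
  exact not_imp_not

theorem ofPoly_smul_twisted {n m : ℕ} (α : Fin m → MvPolynomial (Fin n) ℂ) (β : Fin m → ℂ)
    (f : MvPolynomial (Fin n) ℂ) (u : Twisted α β) :
    Weyl.ofPoly n f • u = toLoc α f • u := by
  induction f using MvPolynomial.induction_on generalizing u with
  | C a =>
    rw [← algebraMap_eq, AlgHom.commutes]
    change weylAction α β (algebraMap ℂ (Weyl n) a) u = _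
    rw [AlgHom.commutes]
    change (a • (show Loc α from u) : Loc α) = toLoc α (algebraMap ℂ _ a) * (show Loc α from u)
    rw [toLoc, ← IsScalarTower.algebraMap_apply, Algebra.smul_def]
  | add f g hf hg => rw [map_add, add_smul, hf, hg, map_add, add_smul]
  | mul_X f i hf => rw [map_mul, mul_smul, Weyl.ofPoly_X, x_smul, hf, map_mul, mul_smul]

/-! ### Subquotients of `ℂ[x]_α` after inverting a polynomial -/

/-- The elements multiplied into `P` by a power of `g`. -/
def saturation {R M : Type*} [CommRing R] [AddCommGroup M] [Module R M] (g : R)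
    (P : Submodule R M) : Submodule R M where
  carrier := {u | ∃ k : ℕ, g ^ k • u ∈ P}
  zero_mem' := ⟨0, by simp⟩
  add_mem' := by
    rintro u v ⟨k, hk⟩ ⟨l, hl⟩
    refine ⟨k + l, ?_⟩
    rw [smul_add]
    refine P.add_mem ?_ ?_
    · rw [add_comm, pow_add, mul_smul]
      exact P.smul_mem _ hk
    · rw [pow_add, mul_smul]
      exact P.smul_mem _ hl
  smul_mem' := by
    rintro c u ⟨k, hk⟩
    exact ⟨k, by rw [smul_comm]; exact P.smul_mem _ hk⟩

section Twisted

variable {n m : ℕ} {α : Fin m → MvPolynomial (Fin n) ℂ} {β : Fin m → ℂ}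

/-! ### Tangential derivatives on `ℂ[x]_α` and on its stable submodules -/

theorem toLoc_smul (c : ℂ) (f : MvPolynomial (Fin n) ℂ) : toLoc α (c • f) = c • toLoc α f :=
  map_smul (IsScalarTower.toAlgHom ℂ (MvPolynomial (Fin n) ℂ) (Loc α)) c f

/-- The extension of `dirDeriv w` to `ℂ[x]_α`. -/
def locDir (α : Fin m → MvPolynomial (Fin n) ℂ) (w : Fin n → ℂ) :
    Derivation ℂ (Loc α) (Loc α) :=
  ∑ j, w j • locD α j

theorem locDir_apply (w : Fin n → ℂ) (u : Loc α) : locDir α w u = ∑ j, w j • locD α j u := by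
  simp [locDir, sum_derivation_apply]

theorem locDir_toLoc (w : Fin n → ℂ) (f : MvPolynomial (Fin n) ℂ) :
    locDir α w (toLoc α f) = toLoc α (dirDeriv w f) := by
  rw [locDir_apply, dirDeriv_apply, map_sum]
  refine Finset.sum_congr rfl fun j _ => ?_
  rw [locD_toLoc, toLoc_smul]

/-- `∑ j, w_j ∂_j(α^β) / α^β`. -/
def logDir (α : Fin m → MvPolynomial (Fin n) ℂ) (β : Fin m → ℂ) (w : Fin n → ℂ) : Loc α :=
  ∑ j, w j • logD α β j

theorem logDir_eq (w : Fin n → ℂ) :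
    logDir α β w =
      ∑ i, β i • (toLoc α (dirDeriv w (α i)) * Ring.inverse (toLoc α (α i))) := by
  simp only [logDir, logD, Finset.smul_sum]
  rw [Finset.sum_comm]
  refine Finset.sum_congr rfl fun i _ => ?_
  rw [← locDir_toLoc, locDir_apply, Finset.sum_mul, Finset.smul_sum]
  refine Finset.sum_congr rfl fun j _ => ?_
  rw [locD_toLoc, smul_mul_assoc, smul_comm]

/-- Grouped by factors, the terms of `logDir` with `i ∈ S` vanish, and each remaining denominator `α
i` divides the product over `Sᶜ`. -/
theorem exists_toLoc_mul_logDir {S : Finset (Fin m)} {w : Fin n → ℂ}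
    (hw : ∀ i ∈ S, dirDeriv w (α i) = 0) :
    ∃ c, toLoc α (∏ i ∈ Sᶜ, α i) * logDir α β w = toLoc α c := by
  suffices h : ∀ i, ∃ c, toLoc α (∏ i ∈ Sᶜ, α i) *
      (β i • (toLoc α (dirDeriv w (α i)) * Ring.inverse (toLoc α (α i)))) = toLoc α c by
    choose c hc using h
    exact ⟨∑ i, c i, by rw [logDir_eq, Finset.mul_sum, map_sum]; simp only [hc]⟩
  intro i
  by_cases hi : i ∈ S
  · exact ⟨0, by rw [hw i hi, map_zero, zero_mul, smul_zero, mul_zero]⟩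
  · obtain ⟨g, hg⟩ := Finset.dvd_prod_of_mem α (Finset.mem_compl.mpr hi)
    refine ⟨β i • (g * dirDeriv w (α i)), ?_⟩
    rw [hg, toLoc_smul, mul_smul_comm, map_mul, map_mul]
    congr 1
    linear_combination (toLoc α g * toLoc α (dirDeriv w (α i))) *
      Ring.mul_inverse_cancel _ (isUnit_loc α i)

/-- Stability of a `ℂ[x]`-submodule of `ℂ[x]_α` under the operators `∂_j` of `M_α^β`. -/
def DStable (β : Fin m → ℂ) (P : Submodule (MvPolynomial (Fin n) ℂ) (Loc α)) : Prop :=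
  ∀ j, ∀ u ∈ P, locD α j u + logD α β j * u ∈ P

theorem DStable.locDir_add_mem {P : Submodule (MvPolynomial (Fin n) ℂ) (Loc α)}
    (hP : DStable β P) (w : Fin n → ℂ) {u : Loc α} (hu : u ∈ P) :
    locDir α w u + logDir α β w * u ∈ P := by
  rw [locDir_apply, logDir, Finset.sum_mul, ← Finset.sum_add_distrib]
  refine P.sum_mem fun j _ => ?_
  rw [smul_mul_assoc, ← smul_add]
  exact P.smul_of_tower_mem _ (hP j u hu)

/-- The twisted derivative preserves `P`, and the twist becomes polynomial after multiplication by
`g`, so subtracting it costs only one more power of `g`. -/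
theorem DStable.locDir_mem_saturation {P : Submodule (MvPolynomial (Fin n) ℂ) (Loc α)}
    (hP : DStable β P) {S : Finset (Fin m)} {w : Fin n → ℂ}
    (hw : ∀ i ∈ S, dirDeriv w (α i) = 0) {u : Loc α}
    (hu : u ∈ saturation (∏ i ∈ Sᶜ, α i) P) :
    locDir α w u ∈ saturation (∏ i ∈ Sᶜ, α i) P := by
  obtain ⟨c, hc⟩ := exists_toLoc_mul_logDir (β := β) hw
  set g := ∏ i ∈ Sᶜ, α i
  obtain ⟨k, hk⟩ := hu
  have h1 := P.smul_mem g (hP.locDir_add_mem w hk)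
  -- With `D = locDir α w` and `c = g * logDir`, the Leibniz rule gives `g ^ (k+1) D u = g (D +
  -- logDir)(g ^ k u) - (k D(g) + c) g ^ k u`.
  have h2 := P.smul_mem (k * dirDeriv w g + c) hk
  refine ⟨k + 1, ?_⟩
  convert P.sub_mem h1 h2 using 1
  simp only [Algebra.smul_def, Derivation.leibniz, locDir_toLoc, map_pow, map_add,
    map_mul, Derivation.leibniz_pow, map_natCast, nsmul_eq_mul] at hc ⊢
  -- The Leibniz rule produces the truncated exponent `k - 1`.
  rcases k with _ | k
  · simp
    linear_combination (-u) * hc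
  · simp
    linear_combination (-toLoc α g ^ (k + 1) * u) * hc

theorem exists_forall_eval_eq_zero (hα : ∀ i, (α i).totalDegree = 1)
    {P Q : Submodule (MvPolynomial (Fin n) ℂ) (Loc α)} (hP : DStable β P) (hQ : DStable β Q)
    {S : Finset (Fin m)} (htors : ∀ i ∈ S, ∀ u ∈ Q, ∃ k : ℕ, α i ^ k • u ∈ P)
    (hinj : ∀ i ∉ S, ∀ u ∈ Q, α i • u ∈ P → u ∈ P) (hne : ∃ u ∈ Q, u ∉ P)
    {p : Fin n → ℂ} (hp : p ∈ flat α S) :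
    ∃ u ∈ Q, ∀ f : MvPolynomial (Fin n) ℂ, f • u ∈ P → eval p f = 0 := by
  set g := ∏ i ∈ Sᶜ, α i with hg
  have hginj : ∀ u ∈ Q, g • u ∈ P → u ∈ P := by
    refine Finset.prod_induction α (fun f => ∀ u ∈ Q, f • u ∈ P → u ∈ P) ?_ ?_ ?_
    · intro a b ha hb u hu h
      rw [mul_smul] at h
      exact hb u hu (ha _ (Q.smul_mem _ hu) h)
    · intro u _ h
      rwa [one_smul] at h
    · exact fun i hi => hinj i (Finset.mem_compl.mp hi)
  have hginj' : ∀ k : ℕ, ∀ u ∈ Q, g ^ k • u ∈ P → u ∈ P := by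
    intro k
    induction k with
    | zero => simp
    | succ k ih =>
      intro u hu h
      rw [pow_succ', mul_smul] at h
      exact ih u hu (hginj _ (Q.smul_mem _ hu) h)
  obtain ⟨u₀, hu₀Q, hu₀P⟩ := hne
  -- The exponent `a` stays fixed while the degree of the numerator is minimized.
  obtain ⟨a, f₀, hf₀⟩ : ∃ (a : ℕ) (f₀ : MvPolynomial (Fin n) ℂ),
      (∏ i, α i) ^ a • u₀ = toLoc α f₀ := by
    obtain ⟨⟨f, ⟨_, a, rfl⟩⟩, h⟩ := IsLocalization.surj (Submonoid.powers (∏ i, α i)) u₀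
    exact ⟨a, f, by rw [Algebra.smul_def, mul_comm]; exact h⟩
  set s := ∏ i ∈ S, α i with hs
  -- a polynomial of least degree among the numerators
  have hex : ∃ d : ℕ, ∃ f : MvPolynomial (Fin n) ℂ, f.totalDegree = d ∧
      ∃ u ∈ saturation g Q, u ∉ saturation g P ∧ s ^ a • u = toLoc α f := by
    -- Multiplying by `g ^ a` leaves only `s ^ a` to clear, since `s * g` is the full product.
    refine ⟨_, f₀, rfl, g ^ a • u₀, ⟨0, Q.smul_mem _ (Q.smul_mem _ hu₀Q)⟩, ?_, ?_⟩
    · rintro ⟨k, hk⟩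
      rw [← mul_smul, ← pow_add] at hk
      exact hu₀P (hginj' _ _ hu₀Q hk)
    · rw [← mul_smul, ← mul_pow, hs, hg, Finset.prod_mul_prod_compl, hf₀]
  classical
  obtain ⟨f, hfd, u, huQ, huP, huf⟩ := Nat.find_spec hex
  have hmin := fun {d} => Nat.find_min hex (m := d)
  have hdu : ∀ w : Fin n → ℂ, (∀ i ∈ S, dirDeriv w (α i) = 0) →
      locDir α w u ∈ saturation g P := by
    intro w hw
    -- Since `s` is constant along `w`, the derivative of `u` has numerator `dirDeriv w f` over the
    -- same `s ^ a`, contradicting minimality. If `f` is constant the degree cannot drop, but then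
    -- the derivative is zero.
    by_contra hcon
    have hsw : dirDeriv w (s ^ a) = 0 := by
      have : dirDeriv w s = 0 := by
        refine Finset.prod_induction α (fun f => dirDeriv w f = 0) ?_ ?_ hw
        · intro b c hb hc
          rw [Derivation.leibniz, hb, hc, smul_zero, smul_zero, add_zero]
        · exact Derivation.map_one_eq_zero _
      rw [Derivation.leibniz_pow, this, smul_zero, smul_zero]
    have hnum : s ^ a • locDir α w u = toLoc α (dirDeriv w f) := by
      rw [← locDir_toLoc, ← huf, Algebra.smul_def, Algebra.smul_def, Derivation.leibniz,
        locDir_toLoc, hsw, map_zero, smul_zero, add_zero, smul_eq_mul]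
    by_cases hf0 : f.totalDegree = 0
    · rw [dirDeriv_eq_zero_of_totalDegree_eq_zero w hf0, map_zero, Algebra.smul_def] at hnum
      have hunit : IsUnit (toLoc α (s ^ a)) := by
        rw [map_pow, hs, map_prod]
        exact (IsUnit.prod_iff.mpr fun i _ => isUnit_loc α i).pow a
      rw [hunit.mul_right_eq_zero.mp hnum] at hcon
      exact hcon (zero_mem _)
    · refine hmin ?_ ⟨dirDeriv w f, rfl, _, hQ.locDir_mem_saturation hw huQ, hcon, hnum⟩
      rw [← hfd]
      have := totalDegree_dirDeriv_le w f
      omega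
  obtain ⟨k, hk⟩ := huQ
  -- The annihilator of the class of `u` modulo the saturation of `P`.
  set I : Ideal (MvPolynomial (Fin n) ℂ) :=
    (saturation g P).comap (LinearMap.toSpanSingleton (MvPolynomial (Fin n) ℂ) (Loc α) u)
  have hmem : ∀ f, f ∈ I ↔ f • u ∈ saturation g P := fun f => Iff.rfl
  have hItop : I ≠ ⊤ := by
    rw [Ideal.ne_top_iff_one, hmem, one_smul]
    exact huP
  obtain ⟨q, hq⟩ := exists_eval_eq_zero_of_ne_top hItop
  have hqS : ∀ i ∈ S, eval q (α i) = 0 := by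
    intro i hi
    obtain ⟨l, hl⟩ := htors i hi _ hk
    have : α i ^ l ∈ I := (hmem _).mpr ⟨k, by rwa [smul_comm]⟩
    have := hq _ this
    rw [map_pow] at this
    exact eq_zero_of_pow_eq_zero this
  have hpS : ∀ i ∈ S, eval p (α i) = 0 := by
    simpa [flat] using hp
  have hw : ∀ i ∈ S, dirDeriv (p - q) (α i) = 0 := fun i hi =>
    dirDeriv_eq_zero_of_eval_eq_zero (hα i) (hqS i hi) (hpS i hi)
  have hIw : ∀ f ∈ I, dirDeriv (p - q) f ∈ I := by
    intro f hf
    rw [hmem] at hf ⊢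
    -- `D(f u) - f D(u) = D(f) u`, and both terms on the left lie in the saturation of `P`.
    have h := sub_mem (hP.locDir_mem_saturation hw hf) ((saturation g P).smul_mem f (hdu _ hw))
    rwa [Algebra.smul_def f u, Derivation.leibniz, locDir_toLoc, Algebra.smul_def f, smul_eq_mul,
      smul_eq_mul, add_sub_cancel_left, mul_comm, ← Algebra.smul_def] at h
  -- The factor `g ^ k` brings `u` back into `Q`; anything killing `g ^ k • u` modulo `P` already
  -- lies in `I`.
  refine ⟨g ^ k • u, hk, fun f hf => ?_⟩
  have hfI : f ∈ I := (hmem f).mpr ⟨k, by rwa [smul_comm]⟩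
  have := eval_add_eq_zero_of_dirDeriv_stable hIw hq hfI
  rwa [add_sub_cancel] at this

/-- A submodule of `M_α^β` as a `ℂ[x]`-submodule of `ℂ[x]_α`. -/
def polySubmodule (P : Submodule (Weyl n) (Twisted α β)) :
    Submodule (MvPolynomial (Fin n) ℂ) (Loc α) where
  carrier := (P : Set (Twisted α β))
  zero_mem' := P.zero_mem
  add_mem' := fun hu hv => P.add_mem hu hv
  smul_mem' := by
    have h : ∀ (f : MvPolynomial (Fin n) ℂ) (u : Twisted α β), u ∈ P → toLoc α f • u ∈ P := by
      intro f u hu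
      rw [← ofPoly_smul_twisted]
      exact P.smul_mem _ hu
    intro f u hu
    rw [Algebra.smul_def]
    exact h f u hu

theorem smul_mem_polySubmodule {P : Submodule (Weyl n) (Twisted α β)}
    {f : MvPolynomial (Fin n) ℂ} {u : Twisted α β} :
    (f • (show Loc α from u) : Loc α) ∈ polySubmodule P ↔ Weyl.ofPoly n f • u ∈ P := by
  rw [ofPoly_smul_twisted, Algebra.smul_def]
  rfl

theorem dStable_polySubmodule (P : Submodule (Weyl n) (Twisted α β)) :
    DStable β (polySubmodule P) := by
  intro j u hu
  have h := P.smul_mem (Weyl.d j) hu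
  have e : Weyl.d j • (show Twisted α β from u) = opD α β j (show Twisted α β from u) := by
    change weylAction α β (Weyl.d j) _ = _
    rw [weylAction, Weyl.lift_d]
  rw [e] at h
  exact h

end Twisted

end HyperplaneDModule

end

/-! ### The main theorem -/

open HyperplaneDModule in
theorem mainTheorem6 {n m : ℕ} (α : Fin m → MvPolynomial (Fin n) ℂ)
    (hα : ∀ i, (α i).totalDegree = 1) (β : Fin m → ℂ)
    {N : Type*} [AddCommGroup N] [Module (HyperplaneDModule.Weyl n) N]
    (hN : HyperplaneDModule.IsDecompositionFactor (HyperplaneDModule.Weyl n) N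
      (HyperplaneDModule.Twisted α β)) :
    ∃ S : Set (Fin m), HyperplaneDModule.supp n N = HyperplaneDModule.flat α S := by
  classical
  obtain ⟨hsimple, P, Q, -, ⟨e⟩⟩ := hN
  let S : Finset (Fin m) := Finset.univ.filter fun i => Weyl.torsion N (α i) = ⊤
  have hS : ∀ i, i ∈ S ↔ Weyl.torsion N (α i) = ⊤ := fun i => by simp [S]
  let cls : Q → N := fun u => e.symm (Submodule.Quotient.mk u)
  have hcls : ∀ (a : Weyl n) (u : Q), a • cls u = 0 ↔ a • (u : Twisted α β) ∈ P := by
    intro a u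
    rw [← map_smul, ← Submodule.Quotient.mk_smul, LinearEquiv.map_eq_zero_iff,
      Submodule.Quotient.mk_eq_zero]
    rfl
  have hsurj : ∀ v : N, ∃ u, cls u = v := by
    intro v
    obtain ⟨u, hu⟩ := Submodule.Quotient.mk_surjective _ (e v)
    exact ⟨u, by simp only [cls, hu, LinearEquiv.symm_apply_apply]⟩
  refine ⟨S, Set.Subset.antisymm ?_ ?_⟩
  · intro p hp
    obtain ⟨v, hv⟩ := mem_supp.mp hp
    simp only [flat, Set.mem_iInter]
    intro i hi
    have : v ∈ Weyl.torsion N (α i) := by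
      rw [(hS i).mp hi]
      trivial
    obtain ⟨k, hk⟩ := this
    have := hv _ hk
    rw [map_pow] at this
    exact eq_zero_of_pow_eq_zero this
  · intro p hp
    obtain ⟨u, huQ, hu⟩ := exists_forall_eval_eq_zero hα (dStable_polySubmodule P)
      (dStable_polySubmodule Q) (S := S) (by
        intro i hi u hu
        have : cls ⟨u, hu⟩ ∈ Weyl.torsion N (α i) := by
          rw [(hS i).mp hi]
          trivial
        obtain ⟨k, hk⟩ := this
        exact ⟨k, smul_mem_polySubmodule.mpr ((hcls _ _).mp hk)⟩) (by
        intro i hi u hu h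
        -- Simplicity turns failure of full torsion into injectivity of `α i` on `N`.
        have hbot : Weyl.torsion N (α i) = ⊥ :=
          (eq_bot_or_eq_top _).resolve_right (mt (hS i).mpr hi)
        have h1 := (hcls _ ⟨u, hu⟩).mpr (smul_mem_polySubmodule.mp h)
        have : cls ⟨u, hu⟩ ∈ Weyl.torsion N (α i) := ⟨1, by rwa [pow_one]⟩
        rw [hbot, Submodule.mem_bot, ← one_smul (Weyl n) (cls _), hcls, one_smul] at this
        exact this) (by
        have := IsSimpleModule.nontrivial (Weyl n) N
        obtain ⟨v, hv⟩ := exists_ne (0 : N)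
        obtain ⟨u, rfl⟩ := hsurj v
        refine ⟨u.1, u.2, fun h => hv ?_⟩
        rw [← one_smul (Weyl n) (cls u), hcls, one_smul]
        exact h) hp
    exact mem_supp.mpr ⟨cls ⟨u, huQ⟩, fun f hf =>
      hu f (smul_mem_polySubmodule.mpr ((hcls _ _).mp hf))⟩
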